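/- Let $P:\mathbf X\to\mathbf B$ be a functor. A morphism $\varphi:Y\to X$ of $\mathbf X$ is \emph{cartesian} if for every $\theta:Z\to X$ and every $v$ with $P(\theta)=P(\varphi)\circ v$ there is a unique $\psi:Z\to Y$ with $P(\psi)=v$ and $\varphi\circ\psi=\theta$; $P$ is a \emph{fibration} if every $u:J\to P(X)$ has a cartesian lift with codomain $X$. A morphism is \emph{vertical} if $P$ sends it to an identity, and a \emph{vertical mono} is a vertical morphism that is a monomorphism in its fibre. Let $P$ be a fibration whose vertical monos are stable under reindexing. For $X$ in the fibre $P(I)$ let $\mathrm{Sub}_I(X)$ be the category whose objects are pairs $(\varphi,m)$ with $\varphi:Y\to X$ cartesian and $m:S\to Y$ a vertical mono, a morphism $(\psi:Z\to X,\;n:T\to Z)\to(\varphi:Y\to X,\;m:S\to Y)$ being a morphism $\theta:Z\to Y$ with $\varphi\circ\theta=\psi$ and $\theta\circ n=m\circ\widetilde\theta$ for some (necessarily unique) cartesian $\widetilde\theta:T\to S$. $P$ is \emph{well-powered} if for all $I\in\mathbf B$ and $X\in P(I)$ the category $\mathrm{Sub}_I(X)$ (which is fibred over $\mathbf B/I$)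 has a terminal object. For a fibration $P$ and $X,Y\in P(I)$ let $\mathrm{Hom}_I(X,Y)$ be the category of spans $X\xleftarrow{\varphi}U\xrightarrow{f}Y$ with $\varphi$ cartesian and $P(\varphi)=P(f)$, with morphisms of spans as morphisms. $P$ is \emph{locally small} if for all $I\in\mathbf B$ and $X,Y\in P(I)$ the category $\mathrm{Hom}_I(X,Y)$ has a terminal object. \textbf{Theorem.} Let $\mathbf B$ be a category with finite limits, and let $P_{\mathbf B}=\partial_1:\mathbf B^{\mathbf 2}\to\mathbf B$ be its fundamental fibration, i.e. the codomain functor on the category of arrows of $\mathbf B$. Then $\mathbf B$ is an elementary topos (it has finite limits, is cartesian closed and has a subobject classifier) if and only if $P_{\mathbf B}$ is well-powered. Moreover, if $P_{\mathbf B}$ is well-powered then $P_{\mathbf B}$ is locally small; and every elementary topos $\mathbf B$ is locally cartesian closed, i.e. for every $u:J\to I$ in $\mathbf B$ the pullback functor $u^{-1}:\mathbf B/I\to\mathbf B/J$ has a right adjoint. -/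

import Mathlib

open CategoryTheory CategoryTheory.Limits CategoryTheory.Functor

universe v u v₁ u₁

namespace FibredCat

section General

variable {B : Type u} [Category.{v} B] {X : Type u₁} [Category.{v₁} X]

/-- A vertical mono with respect to `P`: a morphism of the fibre over `P(Y)`, i.e. a morphism lying
over the identity of `P(Y)`, which is a monomorphism in that fibre. -/
structure IsVerticalMono (P : X ⥤ B) {S Y : X} (m : S ⟶ Y) : Prop where
  isHomLift : P.IsHomLift (𝟙 (P.obj Y)) m
  right_cancel {Z : X} (g h : Z ⟶ S) (_ : P.IsHomLift (𝟙 (P.obj Y)) g)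
    (_ : P.IsHomLift (𝟙 (P.obj Y)) h) : g ≫ m = h ≫ m → g = h

/-- Vertical monos are stable under reindexing: if `φ : Y' ⟶ Y` and `ψ : S' ⟶ S` are cartesian over
the same morphism `w` of the base, `m : S ⟶ Y` is a vertical mono, and `m' : S' ⟶ Y'` is vertical
with `m' ≫ φ = ψ ≫ m` (so that `m'` is the reindexing of `m` along `w`), then `m'` is a vertical
mono. -/
class StableVerticalMonos (P : X ⥤ B) : Prop where
  isVerticalMono {Y Y' S S' : X} {J K : B} (w : J ⟶ K) (φ : Y' ⟶ Y) (ψ : S' ⟶ S)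
    (m : S ⟶ Y) (m' : S' ⟶ Y') (_ : P.IsStronglyCartesian w φ) (_ : P.IsStronglyCartesian w ψ)
    (_ : IsVerticalMono P m) (_ : P.IsHomLift (𝟙 (P.obj Y')) m') (_ : m' ≫ φ = ψ ≫ m) :
    IsVerticalMono P m'

/-- An object of `Sub_I(A)`, for `A` in the fibre of `P` over `I`: a pair `(φ, m)` of a cartesian
morphism `φ : Y ⟶ A` and a vertical mono `m : S ⟶ Y`. Here `base` is `P(φ)`, and
`IsStronglyCartesian` is the notion of cartesian morphism with the universal property against
all morphisms whose image under `P` factors through `P(φ)`. -/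
structure Sub (P : X ⥤ B) {I : B} (A : Fiber P I) where
  Y : X
  S : X
  base : P.obj Y ⟶ I
  φ : Y ⟶ A.1
  cartesian : P.IsStronglyCartesian base φ
  m : S ⟶ Y
  verticalMono : IsVerticalMono P m

namespace Sub

variable {P : X ⥤ B} {I : B} {A : Fiber P I}

/-- A morphism `(ψ, n) ⟶ (φ, m)` of `Sub_I(A)`: a morphism `θ` with `φ ∘ θ = ψ` and
`θ ∘ n = m ∘ θ'` for some cartesian morphism `θ'`. -/
@[ext]
structure Hom (s t : Sub P A) where
  θ : s.Y ⟶ t.Y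
  comm : θ ≫ t.φ = s.φ
  exists_cartesian : ∃ θ' : s.S ⟶ t.S,
    P.IsStronglyCartesian (P.map θ') θ' ∧ s.m ≫ θ = θ' ≫ t.m

instance : Category (Sub P A) where
  Hom := Hom
  id s := ⟨𝟙 s.Y, Category.id_comp _, 𝟙 s.S,
    have : P.IsHomLift (P.map (𝟙 s.S)) (𝟙 s.S) := inferInstance
    IsStronglyCartesian.of_isIso P _ _, by simp⟩
  comp {r s t} f g := ⟨f.θ ≫ g.θ, by rw [Category.assoc, g.comm, f.comm], by
    obtain ⟨f', hf', ef⟩ := f.exists_cartesian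
    obtain ⟨g', hg', eg⟩ := g.exists_cartesian
    refine ⟨f' ≫ g', ?_, ?_⟩
    · rw [P.map_comp]
      infer_instance
    · rw [← Category.assoc, ef, Category.assoc, eg, Category.assoc]⟩
  id_comp f := Hom.ext (Category.id_comp _)
  comp_id f := Hom.ext (Category.comp_id _)
  assoc f g h := Hom.ext (Category.assoc _ _ _)

end Sub

/-- A fibration `P` with vertical monos stable under reindexing is well-powered if, for every
object `I` of the base and every `A` over `I`, the elementary fibration of `Sub_I(A)` over `B/I` is
representable, i.e. the category `Sub_I(A)` has a terminal object. -/
def IsWellPowered (P : X ⥤ B) [P.IsFibered] [StableVerticalMonos P] : Prop :=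
  ∀ (I : B) (A : Fiber P I), HasTerminal (Sub P A)

/-- An object of `Hom_I(A, C)`, for `A`, `C` in the fibre of `P` over `I`: a span of a cartesian
morphism `φ : U ⟶ A` and a morphism `f : U ⟶ C` lying over the same morphism `base` of the base
category. -/
structure SpanHom (P : X ⥤ B) {I : B} (A C : Fiber P I) where
  U : X
  base : P.obj U ⟶ I
  φ : U ⟶ A.1
  cartesian : P.IsStronglyCartesian base φ
  f : U ⟶ C.1
  isHomLift : P.IsHomLift base f

namespace SpanHom

variable {P : X ⥤ B} {I : B} {A C : Fiber P I}

/-- A morphism of `Hom_I(A, C)`: a morphism of spans. -/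
@[ext]
structure Hom (s t : SpanHom P A C) where
  θ : s.U ⟶ t.U
  comm_φ : θ ≫ t.φ = s.φ
  comm_f : θ ≫ t.f = s.f

instance : Category (SpanHom P A C) where
  Hom := Hom
  id s := ⟨𝟙 s.U, Category.id_comp _, Category.id_comp _⟩
  comp f g := ⟨f.θ ≫ g.θ, by rw [Category.assoc, g.comm_φ, f.comm_φ],
    by rw [Category.assoc, g.comm_f, f.comm_f]⟩
  id_comp f := Hom.ext (Category.id_comp _)
  comp_id f := Hom.ext (Category.comp_id _)
  assoc f g h := Hom.ext (Category.assoc _ _ _)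

end SpanHom

/-- A fibration `P` is locally small if all the elementary fibrations `Hom_I(A, C)` over `B/I` are
representable, i.e. the categories `Hom_I(A, C)` have terminal objects. -/
def IsLocallySmall (P : X ⥤ B) [P.IsFibered] : Prop :=
  ∀ (I : B) (A C : Fiber P I), HasTerminal (SpanHom P A C)

end General

section Fundamental

variable (B : Type u) [Category.{v} B]

/-- The codomain functor from the arrow category of `B` to `B`. -/
abbrev fundamentalFibration : Arrow B ⥤ B := Arrow.rightFunc

/-- An elementary topos: a category with finite limits which is cartesian closed (each functor
`A × -` has a right adjoint) and has a subobject classifier. -/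
structure IsElementaryTopos : Prop where
  hasFiniteLimits : HasFiniteLimits B
  cartesianClosed (A : B) : (prod.functor.obj A).IsLeftAdjoint
  hasSubobjectClassifier : HasSubobjectClassifier B

/-- Every pullback functor between slices has a right adjoint. -/
def IsLocallyCartesianClosed [HasPullbacks B] : Prop :=
  ∀ {I J : B} (w : J ⟶ I), (Over.pullback w).IsLeftAdjoint

variable {B}

/-- A morphism of the arrow category lifting `k` has codomain component `k`. -/
theorem right_eq_of_isHomLift {a b : Arrow B} {k : a.right ⟶ b.right} {χ : a ⟶ b}
    (h : (fundamentalFibration B).IsHomLift k χ) : χ.right = k :=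
  (@IsHomLift.eq_of_isHomLift _ _ _ _ (fundamentalFibration B) a b k χ h).symm

theorem isHomLift_right {a b : Arrow B} (χ : a ⟶ b) :
    (fundamentalFibration B).IsHomLift χ.right χ :=
  IsHomLift.map (fundamentalFibration B) χ

/-- Pullback squares are cartesian for the codomain functor. -/
theorem isStronglyCartesian_of_isPullback {a b : Arrow B} (φ : a ⟶ b)
    (h : IsPullback φ.left a.hom b.hom φ.right) :
    (fundamentalFibration B).IsStronglyCartesian φ.right φ where
  toIsHomLift := isHomLift_right φ
  universal_property' {a'} (g : a'.right ⟶ a.right) φ' hφ' := by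
    have e : φ'.right = g ≫ φ.right := right_eq_of_isHomLift hφ'
    have w : φ'.left ≫ b.hom = (a'.hom ≫ g) ≫ φ.right := by
      rw [Category.assoc, ← e]
      exact Arrow.w φ'
    let χ₀ : a' ⟶ a := Arrow.homMk (h.lift φ'.left (a'.hom ≫ g) w) g (h.lift_snd _ _ w)
    refine ⟨χ₀, ⟨isHomLift_right χ₀, ?_⟩, ?_⟩
    · exact Arrow.hom_ext _ _ (h.lift_fst _ _ w) e.symm
    · rintro χ ⟨hχ, eχ⟩
      have e' : χ.right = g := right_eq_of_isHomLift hχ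
      have e1 : χ.left ≫ φ.left = φ'.left := congrArg Arrow.Hom.left eχ
      have e2 : χ.left ≫ a.hom = a'.hom ≫ g := e' ▸ Arrow.w χ
      exact Arrow.hom_ext _ _ (h.hom_ext (e1.trans (h.lift_fst _ _ w).symm)
        (e2.trans (h.lift_snd _ _ w).symm)) e'

instance [HasPullbacks B] : (fundamentalFibration B).IsFibered :=
  Functor.IsFibered.of_exists_isStronglyCartesian fun a R (f : R ⟶ a.right) =>
    ⟨Arrow.mk (pullback.snd a.hom f),
      Arrow.homMk (pullback.fst a.hom f) f pullback.condition,
      isStronglyCartesian_of_isPullback (a := Arrow.mk (pullback.snd a.hom f)) (b := a)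
        (Arrow.homMk (pullback.fst a.hom f) f pullback.condition)
        (IsPullback.of_hasPullback a.hom f)⟩

/-- The domain component of a vertical mono of the codomain functor is a mono. -/
theorem IsVerticalMono.mono_left {S Y : Arrow B} {m : S ⟶ Y}
    (hm : IsVerticalMono (fundamentalFibration B) m) : Mono m.left := by
  obtain ⟨Y₀, J, y, rfl⟩ := Arrow.mk_surjective Y
  obtain ⟨S₀, J', s, rfl⟩ := Arrow.mk_surjective S
  obtain rfl : J' = J :=
    @IsHomLift.domain_eq _ _ _ _ (fundamentalFibration B) _ _ _ _ (𝟙 J) m hm.isHomLift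
  have hr : m.right = 𝟙 J' := right_eq_of_isHomLift hm.isHomLift
  have hs : s = m.left ≫ y := by
    have h : m.left ≫ y = s ≫ m.right := Arrow.w m
    rw [h, hr]
    exact (Category.comp_id s).symm
  refine ⟨fun {T} a b hab => ?_⟩
  have e : a ≫ s = b ≫ s := by
    rw [hs, ← Category.assoc, ← Category.assoc]
    exact congrArg (· ≫ y) hab
  let g : Arrow.mk (a ≫ s) ⟶ Arrow.mk s := Arrow.homMk a (𝟙 J') (Category.comp_id _).symm
  let h : Arrow.mk (a ≫ s) ⟶ Arrow.mk s :=
    Arrow.homMk b (𝟙 J') (e.symm.trans (Category.comp_id _).symm)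
  have := hm.right_cancel g h (isHomLift_right g) (isHomLift_right h) (Arrow.hom_ext _ _ hab rfl)
  exact congrArg Arrow.Hom.left this

instance : StableVerticalMonos (fundamentalFibration B) where
  isVerticalMono {Y Y' S S' J K} w φ ψ m m' hφ hψ hm hl e := by
    obtain rfl : (fundamentalFibration B).obj Y' = J :=
      @IsHomLift.domain_eq _ _ _ _ (fundamentalFibration B) _ _ _ _ w φ hφ.toIsHomLift
    refine ⟨hl, fun {Z} g h hg hh hgh => ?_⟩
    have hmono := hm.mono_left
    have hr : g.right = h.right :=
      (@IsHomLift.fac' _ _ _ _ (fundamentalFibration B) _ _ _ _ (𝟙 _) g hg).trans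
        (@IsHomLift.fac' _ _ _ _ (fundamentalFibration B) _ _ _ _ (𝟙 _) h hh).symm
    have h1 : g ≫ ψ = h ≫ ψ := by
      have h2 : (g ≫ ψ) ≫ m = (h ≫ ψ) ≫ m := by
        rw [Category.assoc, Category.assoc, ← e, ← Category.assoc, hgh, Category.assoc]
      refine Arrow.hom_ext _ _ ?_ (congrArg (· ≫ ψ.right) hr)
      exact (cancel_mono m.left).1 (congrArg Arrow.Hom.left h2)
    exact IsStronglyCartesian.ext (fundamentalFibration B) w ψ (𝟙 _) h1

end Fundamental

end FibredCat

/-!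
The theorem rests on one notion, a power object of `a : A ⟶ I` in the slice over `I`: an object
`P ⟶ I` classifying the relations over `I` between `J ⟶ I` and `a`, for all `J ⟶ I`. The codomain
functor is well-powered exactly when all such power objects exist (`isWellPowered_iff`): its
cartesian morphisms are the pullback squares, so an object of `Sub_I(a)` over `J ⟶ I` is a subobject
of `J ×_I A`, that is, a relation, and a morphism of `Sub_I(a)` is a morphism over `I` along which
one relation is the inverse image of the other (`Sub.exists_hom_iff`). Hence terminal objects of
`Sub_I(a)` are power objects of `a`.

If relative power objects exist, then so do dependent products along every `f : X ⟶ I`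
(`exists_isDependentProduct`): a section over `K ×_I X` of `b : Y ⟶ X` is determined by its graph, a
relation over `I` between `K` and `Y`, and the functional relations form an equalizer inside
`P_I(Y)`. Dependent products specialize to right adjoints of pullback functors, to exponentials, and
to the terminal objects of `Hom_I(A, C)`; the power object of the terminal object is a subobject
classifier. Conversely, in a topos the exponential `Ω ^ A` is a power object of `A`, and the power
object of `a : A ⟶ I` is the part of `I ⨯ Ω ^ A` consisting of the pairs of a point of `I` and a
subset of the fibre of `a` over it (`hasRelativePowerObjects_of_terminal`).

Relations are handled as jointly monic spans and compared on generalized elements, which replaces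
the pasting of pullback squares by equivalences between statements `Related r₁ r₂ x y`.
-/

/-! ### Relations and relative power objects -/

namespace FibredCat

section Relations

attribute [local simp] pullback.lift_fst pullback.lift_snd pullback.lift_fst_assoc
  pullback.lift_snd_assoc

variable {B : Type u} [Category.{v} B]

/-- The generalized elements `x : T ⟶ X` and `y : T ⟶ Y` are related by the relation
`X ← R → Y`: the pair `(x, y)` factors through `R`. -/
def Related {R X Y T : B} (r₁ : R ⟶ X) (r₂ : R ⟶ Y) (x : T ⟶ X) (y : T ⟶ Y) : Prop :=
  ∃ z : T ⟶ R, z ≫ r₁ = x ∧ z ≫ r₂ = y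

/-- The span `X ← R → Y` is a relation: its legs are jointly monic. No product of `X` and `Y`
is needed to say so. -/
def JointlyMonic {R X Y : B} (r₁ : R ⟶ X) (r₂ : R ⟶ Y) : Prop :=
  ∀ ⦃T : B⦄ (z z' : T ⟶ R), z ≫ r₁ = z' ≫ r₁ → z ≫ r₂ = z' ≫ r₂ → z = z'

theorem Related.comp_eq {R X Y I T : B} {r₁ : R ⟶ X} {r₂ : R ⟶ Y} {w : X ⟶ I} {a : Y ⟶ I}
    (e : r₁ ≫ w = r₂ ≫ a) {x : T ⟶ X} {y : T ⟶ Y} (h : Related r₁ r₂ x y) :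
    x ≫ w = y ≫ a := by
  obtain ⟨z, rfl, rfl⟩ := h
  simp [e]

/-- The object `p : P ⟶ I` with the relation `P ← E → A` over `I` is a power object of
`a : A ⟶ I` in the slice over `I`: every relation over `I` between some `w : J ⟶ I` and `a` is the
inverse image of `E` along a unique morphism `J ⟶ P` over `I`. -/
structure IsPowerObject {I A P E : B} (a : A ⟶ I) (p : P ⟶ I) (e₁ : E ⟶ P) (e₂ : E ⟶ A) :
    Prop where
  w : e₁ ≫ p = e₂ ≫ a
  jointlyMonic : JointlyMonic e₁ e₂
  existsUnique {J R : B} (w : J ⟶ I) (r₁ : R ⟶ J) (r₂ : R ⟶ A) :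
    r₁ ≫ w = r₂ ≫ a → JointlyMonic r₁ r₂ → ∃! g : J ⟶ P, g ≫ p = w ∧
      ∀ ⦃T : B⦄ (x : T ⟶ J) (y : T ⟶ A), Related r₁ r₂ x y ↔ Related e₁ e₂ (x ≫ g) y

/-- Morphisms into a power object are equal as soon as they classify the same elements. -/
theorem IsPowerObject.hom_ext [HasPullbacks B] {I A P E : B} {a : A ⟶ I} {p : P ⟶ I} {e₁ : E ⟶ P}
    {e₂ : E ⟶ A} (h : IsPowerObject a p e₁ e₂) {J : B} {g g' : J ⟶ P} (hp : g ≫ p = g' ≫ p)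
    (hg : ∀ ⦃T : B⦄ (x : T ⟶ J) (y : T ⟶ A),
      Related e₁ e₂ (x ≫ g) y ↔ Related e₁ e₂ (x ≫ g') y) : g = g' := by
  have key : ∀ ⦃T : B⦄ (x : T ⟶ J) (y : T ⟶ A),
      Related (pullback.fst g e₁) (pullback.snd g e₁ ≫ e₂) x y ↔ Related e₁ e₂ (x ≫ g) y := by
    intro T x y
    constructor
    · rintro ⟨z, rfl, rfl⟩
      exact ⟨z ≫ pullback.snd g e₁, by simp [pullback.condition], by simp⟩
    · rintro ⟨z, hz, rfl⟩
      exact ⟨pullback.lift x z hz.symm, by simp, by simp⟩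
  refine (h.existsUnique (g ≫ p) (pullback.fst g e₁) (pullback.snd g e₁ ≫ e₂) ?_ ?_).unique
    ⟨rfl, key⟩ ⟨hp.symm, fun T x y => (key x y).trans (hg x y)⟩
  · rw [pullback.condition_assoc, h.w, Category.assoc]
  · intro T z z' h₁ h₂
    refine pullback.hom_ext h₁ (h.jointlyMonic _ _ ?_ (by simpa using h₂))
    rw [Category.assoc, Category.assoc, ← pullback.condition, ← Category.assoc, h₁, Category.assoc]

variable (B) in
/-- Every morphism `a : A ⟶ I` has a power object in the slice over `I`. -/
def HasRelativePowerObjects : Prop :=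
  ∀ ⦃A I : B⦄ (a : A ⟶ I), ∃ (P E : B) (p : P ⟶ I) (e₁ : E ⟶ P) (e₂ : E ⟶ A),
    IsPowerObject a p e₁ e₂

end Relations

/-! ### Dependent products -/

section DependentProducts

attribute [local simp] pullback.lift_fst pullback.lift_snd pullback.lift_fst_assoc
  pullback.lift_snd_assoc

variable {B : Type u} [Category.{v} B] [HasFiniteLimits B]

/-- The base change `j ×_I X : K ×_I X ⟶ Q ×_I X` along `f : X ⟶ I` of a morphism `j : K ⟶ Q`
over `I`. -/
noncomputable def baseChange {I X K Q : B} (f : X ⟶ I) {κ : K ⟶ I} {π : Q ⟶ I} (j : K ⟶ Q)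
    (e : j ≫ π = κ) : pullback κ f ⟶ pullback π f :=
  pullback.lift (pullback.fst κ f ≫ j) (pullback.snd κ f)
    (by rw [Category.assoc, e, pullback.condition])

@[simp]
theorem baseChange_fst {I X K Q : B} (f : X ⟶ I) {κ : K ⟶ I} {π : Q ⟶ I} (j : K ⟶ Q)
    (e : j ≫ π = κ) : baseChange f j e ≫ pullback.fst π f = pullback.fst κ f ≫ j :=
  pullback.lift_fst _ _ _

@[simp]
theorem baseChange_fst_assoc {I X K Q Z : B} (f : X ⟶ I) {κ : K ⟶ I} {π : Q ⟶ I} (j : K ⟶ Q)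
    (e : j ≫ π = κ) (z : Q ⟶ Z) :
    baseChange f j e ≫ pullback.fst π f ≫ z = pullback.fst κ f ≫ j ≫ z := by
  rw [← Category.assoc, baseChange_fst, Category.assoc]

@[simp]
theorem baseChange_snd {I X K Q : B} (f : X ⟶ I) {κ : K ⟶ I} {π : Q ⟶ I} (j : K ⟶ Q)
    (e : j ≫ π = κ) : baseChange f j e ≫ pullback.snd π f = pullback.snd κ f :=
  pullback.lift_snd _ _ _

/-- The object `π : Q ⟶ I` with the evaluation `ε : Q ×_I X ⟶ Y` is a dependent product along
`f : X ⟶ I` of `b : Y ⟶ X`: it represents the sections of `b` over `K ×_I X`, for `K` over `I`. -/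
structure IsDependentProduct {I X Y Q : B} (f : X ⟶ I) (b : Y ⟶ X) (π : Q ⟶ I)
    (ε : pullback π f ⟶ Y) : Prop where
  w : ε ≫ b = pullback.snd π f
  existsUnique {K : B} (κ : K ⟶ I) (h : pullback κ f ⟶ Y) : h ≫ b = pullback.snd κ f →
    ∃! j : K ⟶ Q, ∃ e : j ≫ π = κ, baseChange f j e ≫ ε = h

/-- The functional relations are cut out of the power object `P_I(Y)` as follows. Taking the fibres
of the universal relation is a morphism `e : P_I(Y) ×_I X ⟶ P_X(Y)` over `X`; the inverse image
along `e` of the singleton morphism `σ : Y ⟶ P_X(Y)` is a relation between `P_I(Y)` and `X`. A point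
of `P_I(Y)` is functional when all of `X` is related to it, and these points form the equalizer of
two morphisms to `P_I(X)`. -/
theorem exists_isDependentProduct (hB : HasRelativePowerObjects B) {I X Y : B} (f : X ⟶ I)
    (b : Y ⟶ X) : ∃ (Q : B) (π : Q ⟶ I) (ε : pullback π f ⟶ Y), IsDependentProduct f b π ε := by
  obtain ⟨Q, E, q, e₁, e₂, hQ⟩ := hB (b ≫ f)
  obtain ⟨P, F, p, f₁, f₂, hP⟩ := hB b
  obtain ⟨S, G, s, g₁, g₂, hS⟩ := hB f
  -- `e` sends `(k, x)` to the set of all `y` over `x` in the subset `k`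
  have hE : e₁ ≫ q = (e₂ ≫ b) ≫ f := by rw [hQ.w, Category.assoc]
  obtain ⟨e, ⟨ep, he⟩, -⟩ := hP.existsUnique (pullback.snd q f)
    (pullback.lift e₁ (e₂ ≫ b) hE) e₂ (by simp) (fun T z z' h₁ h₂ => hQ.jointlyMonic _ _
      (by simpa using congrArg (· ≫ pullback.fst q f) h₁) h₂)
  have he' : ∀ ⦃T : B⦄ (x : T ⟶ pullback q f) (y : T ⟶ Y), Related f₁ f₂ (x ≫ e) y ↔
      Related e₁ e₂ (x ≫ pullback.fst q f) y ∧ y ≫ b = x ≫ pullback.snd q f := by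
    intro T x y
    rw [← he]
    constructor
    · rintro ⟨z, rfl, rfl⟩
      exact ⟨⟨z, by simp, rfl⟩, by simp⟩
    · rintro ⟨⟨z, h₁, rfl⟩, h₂⟩
      exact ⟨z, pullback.hom_ext (by simpa using h₁) (by simpa using h₂), rfl⟩
  -- the singleton morphism
  obtain ⟨σ, ⟨σp, hσ⟩, -⟩ := hP.existsUnique b (𝟙 Y) (𝟙 Y) rfl
    (fun T z z' h₁ _ => by simpa using h₁)
  have hσ' : ∀ ⦃T : B⦄ (y y' : T ⟶ Y), Related f₁ f₂ (y ≫ σ) y' ↔ y = y' := by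
    intro T y y'
    rw [← hσ]
    exact ⟨fun ⟨z, h₁, h₂⟩ => by simp_all, fun h => ⟨y, by simp, by simpa using h⟩⟩
  have : Mono σ := ⟨fun y y' h => ((hσ' y' y).1 (h ▸ (hσ' y y).2 rfl)).symm⟩
  -- `t` sends `k` to the set of all `x` over which the subset `k` is a singleton
  obtain ⟨t, ⟨tp, ht⟩, -⟩ := hS.existsUnique q (pullback.fst e σ ≫ pullback.fst q f)
    (pullback.fst e σ ≫ pullback.snd q f) (by simp [pullback.condition])
    (fun T z z' h₁ h₂ => (cancel_mono (pullback.fst e σ)).1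
      (pullback.hom_ext (by simpa using h₁) (by simpa using h₂)))
  -- `u` is constant at the largest subset of `X`
  obtain ⟨u, ⟨up, hu⟩, -⟩ := hS.existsUnique q (pullback.fst q f) (pullback.snd q f)
    pullback.condition (fun T z z' h₁ h₂ => pullback.hom_ext h₁ h₂)
  -- `t` and `u` agree at `j` exactly when all the fibres of the subset `j` are singletons
  have hι : ∀ ⦃K : B⦄ (κ : K ⟶ I) (j : K ⟶ Q) (hj : j ≫ q = κ), j ≫ t = j ≫ u ↔
      ∃ h : pullback κ f ⟶ Y, baseChange f j hj ≫ e = h ≫ σ := by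
    intro K κ j hj
    constructor
    · intro h
      obtain ⟨z, h₁, h₂⟩ := (ht (pullback.fst κ f ≫ j) (pullback.snd κ f)).2 (by
        rw [Category.assoc, h, ← Category.assoc, ← hu]
        exact ⟨baseChange f j hj, by simp, by simp⟩)
      refine ⟨z ≫ pullback.snd e σ, ?_⟩
      rw [Category.assoc, ← pullback.condition, ← Category.assoc]
      congr 1
      exact pullback.hom_ext (by simpa using h₁.symm) (by simpa using h₂.symm)
    · rintro ⟨h, eh⟩
      refine hS.hom_ext (by simp [tp, up]) fun T x y => ?_
      rw [← Category.assoc, ← Category.assoc, ← ht, ← hu]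
      constructor
      · rintro ⟨z, h₁, rfl⟩
        exact ⟨z ≫ pullback.fst e σ, by simpa using h₁, by simp⟩
      · rintro ⟨z, h₁, rfl⟩
        have hw : x ≫ κ = (z ≫ pullback.snd q f) ≫ f := by
          rw [← hj, ← Category.assoc, ← h₁, Category.assoc, pullback.condition, Category.assoc]
        have hz : z ≫ e = (pullback.lift x (z ≫ pullback.snd q f) hw ≫ h) ≫ σ := by
          rw [Category.assoc, ← eh, ← Category.assoc]
          congr 1
          exact pullback.hom_ext (by simp [h₁]) (by simp)
        exact ⟨pullback.lift z _ hz, by simpa using h₁, by simp⟩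
  -- the graph of `h` is the relation classified by `j`
  have hgraph : ∀ ⦃K : B⦄ (κ : K ⟶ I) (j : K ⟶ Q) (hj : j ≫ q = κ) (h : pullback κ f ⟶ Y)
      (_ : h ≫ b = pullback.snd κ f),
      baseChange f j hj ≫ e = h ≫ σ ↔
      ∀ ⦃T : B⦄ (x : T ⟶ K) (y : T ⟶ Y),
        Related (pullback.fst κ f) h x y ↔ Related e₁ e₂ (x ≫ j) y := by
    intro K κ j hj h hb
    constructor
    · intro eh T x y
      constructor
      · rintro ⟨z, rfl, rfl⟩
        have := (he' (z ≫ baseChange f j hj) (z ≫ h)).1 (by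
            rw [Category.assoc, eh, ← Category.assoc, hσ'])
        simpa using this.1
      · intro hr
        have hw : x ≫ κ = (y ≫ b) ≫ f := by
          rw [← hj, ← Category.assoc, hr.comp_eq hQ.w, Category.assoc]
        refine ⟨pullback.lift x (y ≫ b) hw, by simp, ?_⟩
        rw [← hσ', Category.assoc, ← eh, ← Category.assoc, he']
        exact ⟨by simpa using hr, by simp⟩
    · intro hr
      refine hP.hom_ext (by simp [ep, σp, hb]) fun T x y => ?_
      rw [← Category.assoc, ← Category.assoc, he', hσ']
      simp only [Category.assoc, baseChange_fst, baseChange_snd]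
      rw [← Category.assoc, ← hr]
      constructor
      · rintro ⟨⟨z, h₁, rfl⟩, h₂⟩
        rw [show x = z from pullback.hom_ext h₁.symm (by rw [← h₂, Category.assoc, hb])]
      · rintro rfl
        exact ⟨⟨x, rfl, rfl⟩, by simp [hb]⟩
  obtain ⟨ε, hε⟩ := (hι (equalizer.ι t u ≫ q) (equalizer.ι t u) rfl).1 (equalizer.condition t u)
  have hεb : ε ≫ b = pullback.snd (equalizer.ι t u ≫ q) f := by
    rw [← σp, ← Category.assoc, ← hε]
    simp [ep]
  have hcomp : ∀ ⦃K : B⦄ (κ : K ⟶ I) (j : K ⟶ equalizer t u)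
      (hj : j ≫ equalizer.ι t u ≫ q = κ) (h : pullback κ f ⟶ Y),
      baseChange f j hj ≫ ε = h ↔
      baseChange f (j ≫ equalizer.ι t u) ((Category.assoc _ _ _).trans hj) ≫ e = h ≫ σ := by
    intro K κ j hj h
    rw [← cancel_mono σ, Category.assoc, ← hε, ← Category.assoc]
    have : baseChange f j hj ≫ baseChange f (equalizer.ι t u) rfl =
      baseChange f (j ≫ equalizer.ι t u) ((Category.assoc _ _ _).trans hj) :=
      pullback.hom_ext (by simp) (by simp)
    rw [this]
  refine ⟨equalizer t u, equalizer.ι t u ≫ q, ε, hεb, fun {K} κ h hb => ?_⟩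
  obtain ⟨j, ⟨hj, hr⟩, huniq⟩ := hQ.existsUnique κ (pullback.fst κ f) h
    (by rw [← Category.assoc, hb, pullback.condition])
    (fun T z z' h₁ h₂ => pullback.hom_ext h₁
      (by rw [← hb, ← Category.assoc, h₂, Category.assoc]))
  have hj' := (hgraph κ j hj h hb).2 hr
  refine ⟨equalizer.lift j ((hι κ j hj).2 ⟨h, hj'⟩), ⟨by simp [hj], ?_⟩, ?_⟩
  · rw [hcomp _ _ (by simp [hj])]
    simpa using hj'
  · rintro j' ⟨ej', hj''⟩
    refine (cancel_mono (equalizer.ι t u)).1 ?_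
    rw [equalizer.lift_ι]
    exact huniq _ ⟨by simpa using ej', (hgraph κ _ (by simpa using ej') h hb).1
      ((hcomp κ j' ej' h).1 hj'')⟩

end DependentProducts

/-! ### Power objects and elementary toposes -/

section Topos

variable {B : Type u} [Category.{v} B] [HasFiniteLimits B]

attribute [local simp] pullback.lift_fst pullback.lift_snd pullback.lift_fst_assoc
  pullback.lift_snd_assoc prod.lift_fst prod.lift_snd prod.lift_fst_assoc prod.lift_snd_assoc

/-- `F` has a right adjoint as soon as every object `Y` has a couniversal arrow from `F`. -/
theorem isLeftAdjoint_of_couniversal {C D : Type*} [Category* C] [Category* D] (F : C ⥤ D)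
    (h : ∀ Y : D, ∃ (G : C) (ε : F.obj G ⟶ Y), ∀ (X : C) (g : F.obj X ⟶ Y),
      ∃! j : X ⟶ G, F.map j ≫ ε = g) : F.IsLeftAdjoint := by
  have (Y : D) : HasTerminal (CostructuredArrow F Y) := by
    obtain ⟨G, ε, hε⟩ := h Y
    refine IsTerminal.hasTerminal (X := CostructuredArrow.mk ε) (IsTerminal.ofUniqueHom
      (fun X => CostructuredArrow.homMk (hε X.left X.hom).choose
        (hε X.left X.hom).choose_spec.1) fun X m => ?_)
    exact CostructuredArrow.hom_ext _ _ ((hε X.left X.hom).choose_spec.2 _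
      (CostructuredArrow.w m))
  exact isLeftAdjoint_of_costructuredArrowTerminals F

/-- Cartesian closedness is the case of dependent products of `A ⨯ Y` along `A ⟶ ⊤`. -/
theorem isLeftAdjoint_prod_functor (hB : HasRelativePowerObjects B) (A : B) :
    (prod.functor.obj A).IsLeftAdjoint := by
  refine isLeftAdjoint_of_couniversal _ fun Y => ?_
  change ∃ (Q : B) (ε : A ⨯ Q ⟶ Y), ∀ (K : B) (g : A ⨯ K ⟶ Y),
    ∃! j : K ⟶ Q, prod.map (𝟙 A) j ≫ ε = g
  obtain ⟨Q, π, ε, hε⟩ := exists_isDependentProduct hB (terminal.from A) (prod.fst : A ⨯ Y ⟶ A)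
  have hl : ∀ {K : B} (κ : K ⟶ ⊤_ B), (prod.snd : A ⨯ K ⟶ K) ≫ κ = prod.fst ≫ terminal.from A :=
    fun κ => Subsingleton.elim _ _
  -- `A ⨯ K` is a pullback of `K` and `A` over the terminal object
  have hinv : ∀ {K : B} (κ : K ⟶ ⊤_ B), prod.lift (pullback.snd κ (terminal.from A))
      (pullback.fst κ (terminal.from A)) ≫ pullback.lift prod.snd prod.fst (hl κ) = 𝟙 _ :=
    fun κ => pullback.hom_ext (by simp) (by simp)
  have hinv' : ∀ {K : B} (κ : K ⟶ ⊤_ B), pullback.lift prod.snd prod.fst (hl κ) ≫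
      prod.lift (pullback.snd κ (terminal.from A)) (pullback.fst κ (terminal.from A)) = 𝟙 _ :=
    fun κ => Limits.prod.hom_ext (by simp) (by simp)
  refine ⟨Q, pullback.lift prod.snd prod.fst (hl π) ≫ ε ≫ prod.snd, fun K g => ?_⟩
  have key : ∀ j : K ⟶ Q, baseChange (terminal.from A) j (Subsingleton.elim _ _) ≫ ε =
      prod.lift (pullback.snd _ _) (prod.lift (pullback.snd (terminal.from K) (terminal.from A))
      (pullback.fst (terminal.from K) (terminal.from A)) ≫ g) ↔
      prod.map (𝟙 A) j ≫ pullback.lift prod.snd prod.fst (hl π) ≫ ε ≫ prod.snd = g := by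
    intro j
    have e : prod.map (𝟙 A) j ≫ pullback.lift prod.snd prod.fst (hl π) =
        pullback.lift prod.snd prod.fst (hl (terminal.from K)) ≫
          baseChange (terminal.from A) j (Subsingleton.elim _ _) :=
      pullback.hom_ext (by simp) (by simp)
    rw [← Category.assoc, e, Category.assoc]
    constructor
    · intro h
      have := congrArg (· ≫ prod.snd) h
      simp only [Category.assoc, prod.lift_snd] at this
      rw [this, ← Category.assoc, hinv', Category.id_comp]
    · rintro rfl
      refine Limits.prod.hom_ext (by simp [hε.w]) ?_
      rw [prod.lift_snd, ← Category.assoc, hinv, Category.id_comp, Category.assoc]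
  obtain ⟨j, ⟨_, hj⟩, huniq⟩ := hε.existsUnique (terminal.from K)
    (prod.lift (pullback.snd _ _) (prod.lift (pullback.snd (terminal.from K) (terminal.from A))
      (pullback.fst (terminal.from K) (terminal.from A)) ≫ g)) (by simp)
  exact ⟨j, (key j).1 hj, fun j' hj' => huniq j' ⟨Subsingleton.elim _ _, (key j').2 hj'⟩⟩

theorem isLocallyCartesianClosed_of_hasRelativePowerObjects (hB : HasRelativePowerObjects B) :
    IsLocallyCartesianClosed B := by
  intro I X f
  refine isLeftAdjoint_of_couniversal _ fun Y => ?_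
  obtain ⟨Q, π, ε, hε⟩ := exists_isDependentProduct hB f Y.hom
  refine ⟨Over.mk π, Over.homMk ε hε.w, fun K g => ?_⟩
  obtain ⟨j, ⟨hj, ej⟩, huniq⟩ := hε.existsUnique K.hom g.left (Over.w g)
  have hmap : ∀ j : K ⟶ Over.mk π, ((Over.pullback f).map j).left =
      baseChange f j.left (Over.w j) := fun j => pullback.hom_ext (by simp) (by simp)
  refine ⟨Over.homMk j hj, ?_, fun j' hj' => ?_⟩
  · ext
    rw [Over.comp_left, hmap]
    exact ej
  · ext
    refine huniq _ ⟨Over.w j', ?_⟩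
    rw [← hj', Over.comp_left, hmap]
    rfl

/-- The power object of the terminal object is a subobject classifier. -/
theorem hasSubobjectClassifier_of_hasRelativePowerObjects (hB : HasRelativePowerObjects B) :
    HasSubobjectClassifier B := by
  obtain ⟨P, E, p, e₁, e₂, hP⟩ := hB (𝟙 (⊤_ B))
  have he₁ : Mono e₁ := ⟨fun z z' h => hP.jointlyMonic z z' h (Subsingleton.elim _ _)⟩
  -- a subobject of `X` is a relation between `X` and the terminal object
  have hclass : ∀ {U X : B} (m : U ⟶ X) [Mono m], ∃! g : X ⟶ P, ∀ ⦃T : B⦄ (x : T ⟶ X),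
      (∃ z, z ≫ m = x) ↔ ∃ z, z ≫ e₁ = x ≫ g := by
    intro U X m _
    obtain ⟨g, ⟨-, hg⟩, huniq⟩ := hP.existsUnique (terminal.from X) m (terminal.from U)
      (Subsingleton.elim _ _) (fun T z z' h _ => (cancel_mono m).1 h)
    refine ⟨g, fun T x => ?_, fun g' hg' => huniq g' ⟨Subsingleton.elim _ _, fun T x y => ?_⟩⟩
    · exact ⟨fun ⟨z, hz⟩ => ((hg x (terminal.from T)).1 ⟨z, hz, Subsingleton.elim _ _⟩).imp
        fun _ h => h.1, fun ⟨z, hz⟩ => ((hg x (terminal.from T)).2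
          ⟨z, hz, Subsingleton.elim _ _⟩).imp fun _ h => h.1⟩
    · exact ⟨fun ⟨z, hz, _⟩ => ((hg' x).1 ⟨z, hz⟩).imp fun _ h => ⟨h, Subsingleton.elim _ _⟩,
        fun ⟨z, hz, _⟩ => ((hg' x).2 ⟨z, hz⟩).imp fun _ h => ⟨h, Subsingleton.elim _ _⟩⟩
  -- `E` is terminal: two morphisms to `E` both classify the largest subobject
  have hE : ∀ U : B, Nonempty (Unique (U ⟶ E)) := by
    intro U
    obtain ⟨g, hg, huniq⟩ := hclass (𝟙 U)
    obtain ⟨z, hz⟩ := (hg (𝟙 U)).1 ⟨𝟙 U, by simp⟩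
    refine ⟨⟨⟨z⟩, fun z' => (cancel_mono e₁).1 ?_⟩⟩
    rw [huniq (z' ≫ e₁) fun T x => ⟨fun _ => ⟨x ≫ z', by simp⟩, fun _ => ⟨x, by simp⟩⟩]
    exact (huniq (z ≫ e₁) fun T x => ⟨fun _ => ⟨x ≫ z, by simp⟩, fun _ => ⟨x, by simp⟩⟩).symm
  have (U : B) : Unique (U ⟶ E) := (hE U).some
  refine ⟨⟨Subobject.Classifier.mkOfTerminalΩ₀ E (IsTerminal.ofUnique E) P e₁
    (fun m _ => (hclass m).choose) ?_ ?_⟩⟩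
  · intro U X m _
    have hg := (hclass m).choose_spec.1
    set g := (hclass m).choose
    obtain ⟨z, hz⟩ := (hg m).1 ⟨𝟙 U, by simp⟩
    obtain rfl : z = (IsTerminal.ofUnique E).from U := Subsingleton.elim _ _
    refine ⟨⟨hz.symm⟩, ⟨PullbackCone.IsLimit.mk _
      (fun s => ((hg s.fst).2 ⟨s.snd, s.condition.symm⟩).choose)
      (fun s => ((hg s.fst).2 ⟨s.snd, s.condition.symm⟩).choose_spec)
      (fun s => Subsingleton.elim _ _) fun s l h _ => (cancel_mono m).1 ?_⟩⟩
    rw [h, ((hg s.fst).2 ⟨s.snd, s.condition.symm⟩).choose_spec]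
  · intro U X m _ g hg
    refine (hclass m).choose_spec.2 g fun T x => ⟨?_, fun ⟨z, hz⟩ => ?_⟩
    · rintro ⟨z, rfl⟩
      exact ⟨z ≫ (IsTerminal.ofUnique E).from U, by rw [Category.assoc, Category.assoc, hg.w]⟩
    · exact ⟨hg.lift x z hz.symm, hg.lift_fst _ _ _⟩

theorem isElementaryTopos_of_hasRelativePowerObjects (hB : HasRelativePowerObjects B) :
    IsElementaryTopos B where
  hasFiniteLimits := inferInstance
  cartesianClosed := isLeftAdjoint_prod_functor hB
  hasSubobjectClassifier := hasSubobjectClassifier_of_hasRelativePowerObjects hB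

/-- In a topos, the exponential `Ω ^ A` is a power object of `A`. -/
theorem IsElementaryTopos.exists_isPowerObject_terminal (hB : IsElementaryTopos B) (A : B) :
    ∃ (P E : B) (e₁ : E ⟶ P) (e₂ : E ⟶ A),
      IsPowerObject (terminal.from A) (terminal.from P) e₁ e₂ := by
  obtain ⟨⟨c⟩⟩ := hB.hasSubobjectClassifier
  have := hB.cartesianClosed A
  let adj := Adjunction.ofIsLeftAdjoint (prod.functor.obj A)
  let P := (rightAdjoint (prod.functor.obj A)).obj c.Ω
  let ev : A ⨯ P ⟶ c.Ω := adj.counit.app c.Ω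
  -- `g` classifies a relation when its transpose is the characteristic morphism of the relation
  have htest : ∀ {R J : B} (r₁ : R ⟶ J) (r₂ : R ⟶ A) [Mono (prod.lift r₂ r₁)] (g : J ⟶ P),
      prod.map (𝟙 A) g ≫ ev = c.χ (prod.lift r₂ r₁) ↔
      ∀ ⦃T : B⦄ (x : T ⟶ J) (y : T ⟶ A), Related r₁ r₂ x y ↔
        Related (pullback.fst ev c.truth ≫ prod.snd) (pullback.fst ev c.truth ≫ prod.fst)
          (x ≫ g) y := by
    intro R J r₁ r₂ _ g
    have hE : ∀ ⦃T : B⦄ (x : T ⟶ J) (y : T ⟶ A),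
        Related (pullback.fst ev c.truth ≫ prod.snd) (pullback.fst ev c.truth ≫ prod.fst)
          (x ≫ g) y ↔
        prod.lift y x ≫ prod.map (𝟙 A) g ≫ ev = c.χ₀ T ≫ c.truth := by
      intro T x y
      have e : prod.lift y x ≫ prod.map (𝟙 A) g = prod.lift y (x ≫ g) :=
        Limits.prod.hom_ext (by simp) (by simp)
      rw [← Category.assoc, e]
      constructor
      · rintro ⟨z, h₁, h₂⟩
        have : z ≫ pullback.fst ev c.truth = prod.lift y (x ≫ g) :=
          Limits.prod.hom_ext (by simpa using h₂) (by simpa using h₁)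
        rw [← this, Category.assoc, pullback.condition, ← Category.assoc]
        congr 1
        exact Subsingleton.elim _ _
      · intro h
        exact ⟨pullback.lift _ _ h, by simp, by simp⟩
    constructor
    · intro h T x y
      rw [hE, h]
      constructor
      · rintro ⟨z, rfl, rfl⟩
        rw [← prod.comp_lift, Category.assoc, (c.isPullback _).w, ← Category.assoc]
        congr 1
        exact Subsingleton.elim _ _
      · intro hx
        have := (c.isPullback (prod.lift r₂ r₁)).lift_fst _ _ hx
        exact ⟨(c.isPullback (prod.lift r₂ r₁)).lift _ _ hx,
          by simpa using congrArg (· ≫ prod.snd) this, by simpa using congrArg (· ≫ prod.fst) this⟩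
    · intro h
      have hl : ∀ {T : B} (t : T ⟶ A ⨯ J) (v : T ⟶ c.Ω₀),
          t ≫ prod.map (𝟙 A) g ≫ ev = v ≫ c.truth → ∃ z, z ≫ prod.lift r₂ r₁ = t := by
        intro T t v ht
        obtain ⟨z, h₁, h₂⟩ := (h (t ≫ prod.snd) (t ≫ prod.fst)).2 ((hE _ _).2 (by
          rw [← prod.comp_lift, prod.lift_fst_snd, Category.comp_id, ht,
            Subsingleton.elim v (c.χ₀ T)]))
        exact ⟨z, Limits.prod.hom_ext (by simpa using h₂) (by simpa using h₁)⟩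
      refine c.uniq (prod.lift r₂ r₁) (χ₀' := c.χ₀ R)
        ⟨⟨(hE r₁ r₂).1 ((h r₁ r₂).1 ⟨𝟙 R, by simp, by simp⟩)⟩, ⟨PullbackCone.IsLimit.mk _
        (fun s => (hl s.fst s.snd s.condition).choose)
        (fun s => (hl s.fst s.snd s.condition).choose_spec) (fun s => Subsingleton.elim _ _)
        fun s l h₁ _ => (cancel_mono (prod.lift r₂ r₁)).1 ?_⟩⟩
      rw [h₁, (hl s.fst s.snd s.condition).choose_spec]
  refine ⟨P, _, pullback.fst ev c.truth ≫ prod.snd, pullback.fst ev c.truth ≫ prod.fst,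
    Subsingleton.elim _ _, ?_, ?_⟩
  · intro T z z' h₁ h₂
    refine (cancel_mono (pullback.fst ev c.truth)).1 (Limits.prod.hom_ext ?_ ?_)
    · simpa using h₂
    · simpa using h₁
  · intro J R w r₁ r₂ _ hr
    have : Mono (prod.lift r₂ r₁) := ⟨fun z z' h => hr z z'
      (by simpa using congrArg (· ≫ prod.snd) h) (by simpa using congrArg (· ≫ prod.fst) h)⟩
    have hev : ∀ (g : J ⟶ P) (χ : A ⨯ J ⟶ c.Ω), prod.map (𝟙 A) g ≫ ev = χ ↔
        g = adj.homEquiv J c.Ω χ := by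
      intro g χ
      have h := (adj.homEquiv J c.Ω).symm_apply_eq (x := g) (y := χ)
      rw [adj.homEquiv_counit] at h
      exact h
    refine ⟨_, ⟨Subsingleton.elim _ _, (htest r₁ r₂ _).1 ((hev _ _).2 rfl)⟩, fun g hg => ?_⟩
    exact (hev g _).1 ((htest r₁ r₂ g).2 hg.2)

/-- The power object of `a : A ⟶ I` is the part of `I ⨯ P(A)` of pairs `(i, s)` with `s` contained
in the fibre of `a` over `i`, i.e. such that `s` is equal to its intersection with that fibre. -/
theorem hasRelativePowerObjects_of_terminal
    (hB : ∀ A : B, ∃ (P E : B) (e₁ : E ⟶ P) (e₂ : E ⟶ A),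
      IsPowerObject (terminal.from A) (terminal.from P) e₁ e₂) : HasRelativePowerObjects B := by
  intro A I a
  obtain ⟨V, E, e₁, e₂, hV⟩ := hB A
  -- `m` sends `(i, s)` to the intersection of `s` with the fibre of `a` over `i`
  obtain ⟨m, ⟨-, hm⟩, -⟩ := hV.existsUnique (terminal.from (I ⨯ V)) (prod.lift (e₂ ≫ a) e₁) e₂
    (Subsingleton.elim _ _) (fun T z z' h₁ h₂ => hV.jointlyMonic z z'
      (by simpa using congrArg (· ≫ prod.snd) h₁) h₂)
  have hm' : ∀ ⦃T : B⦄ (k : T ⟶ I ⨯ V) (y : T ⟶ A), Related e₁ e₂ (k ≫ m) y ↔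
      Related e₁ e₂ (k ≫ prod.snd) y ∧ k ≫ prod.fst = y ≫ a := by
    intro T k y
    rw [← hm]
    constructor
    · rintro ⟨z, rfl, rfl⟩
      exact ⟨⟨z, by simp, rfl⟩, by simp⟩
    · rintro ⟨⟨z, h₁, rfl⟩, h₂⟩
      exact ⟨z, Limits.prod.hom_ext (by simp [h₂]) (by simpa using h₁), rfl⟩
  let ι := equalizer.ι m (prod.snd : I ⨯ V ⟶ V)
  have hι : ι ≫ m = ι ≫ prod.snd := equalizer.condition _ _
  have hE : ∀ ⦃T : B⦄ (k : T ⟶ equalizer m (prod.snd : I ⨯ V ⟶ V)) (y : T ⟶ A),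
      Related (pullback.fst (ι ≫ prod.snd) e₁) (pullback.snd (ι ≫ prod.snd) e₁ ≫ e₂) k y ↔
        Related e₁ e₂ (k ≫ ι ≫ prod.snd) y := by
    intro T k y
    constructor
    · rintro ⟨z, rfl, rfl⟩
      exact ⟨z ≫ pullback.snd _ e₁, by simp [pullback.condition], by simp⟩
    · rintro ⟨z, hz, rfl⟩
      exact ⟨pullback.lift k z hz.symm, by simp, by simp⟩
  refine ⟨_, _, ι ≫ prod.fst, pullback.fst (ι ≫ prod.snd) e₁, pullback.snd (ι ≫ prod.snd) e₁ ≫ e₂,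
    ?_, ?_, ?_⟩
  · have := (hE (pullback.fst (ι ≫ prod.snd) e₁) (pullback.snd (ι ≫ prod.snd) e₁ ≫ e₂)).1
      ⟨𝟙 _, by simp, by simp⟩
    have h := (hm' (pullback.fst (ι ≫ prod.snd) e₁ ≫ ι) _).1
      (by rw [Category.assoc, hι]; exact this)
    simpa using h.2
  · intro T z z' h₁ h₂
    refine pullback.hom_ext h₁ (hV.jointlyMonic _ _ ?_ (by simpa using h₂))
    rw [Category.assoc, Category.assoc, ← pullback.condition, ← Category.assoc, h₁, Category.assoc]
  · intro J R w r₁ r₂ hw hr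
    obtain ⟨r, ⟨-, hr'⟩, huniq⟩ := hV.existsUnique (terminal.from J) r₁ r₂
      (Subsingleton.elim _ _) hr
    -- a relation over `I` is contained in the fibres of `a`
    have hk : prod.lift w r ≫ m = prod.lift w r ≫ prod.snd := by
      refine hV.hom_ext (Subsingleton.elim _ _) fun T x y => ?_
      rw [← Category.assoc, hm', Category.assoc, and_iff_left_iff_imp, Category.assoc,
        prod.lift_fst, prod.lift_snd, ← hr']
      exact fun h => h.comp_eq hw
    refine ⟨equalizer.lift _ hk, ⟨?_, fun T x y => ?_⟩, ?_⟩
    · simp [ι]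
    · rw [hE, hr']
      simp [ι]
    · rintro g ⟨hg, hg'⟩
      refine (cancel_mono ι).1 (Limits.prod.hom_ext ?_ ?_)
      · simpa [ι] using hg
      · rw [Category.assoc, huniq (g ≫ ι ≫ prod.snd) ⟨Subsingleton.elim _ _, fun T x y => ?_⟩]
        · simp [ι]
        · rw [hg', hE, Category.assoc]

theorem IsElementaryTopos.hasRelativePowerObjects (hB : IsElementaryTopos B) :
    HasRelativePowerObjects B :=
  hasRelativePowerObjects_of_terminal hB.exists_isPowerObject_terminal

end Topos

/-! ### Well-poweredness of the codomain functor -/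

section WellPowered

variable {B : Type u} [Category.{v} B]

/-- Cartesian morphisms for the codomain functor are pullback squares. -/
theorem isPullback_of_isStronglyCartesian {a b : Arrow B} (χ : a ⟶ b)
    (h : (fundamentalFibration B).IsStronglyCartesian χ.right χ) :
    IsPullback χ.left a.hom b.hom χ.right := by
  -- a cone `(x, y)` over the square is a morphism to `b` from the arrow `y`
  have key : ∀ {T : B} (x : T ⟶ b.left) (y : T ⟶ a.right), x ≫ b.hom = y ≫ χ.right →
      ∃ l : T ⟶ a.left, l ≫ χ.left = x ∧ l ≫ a.hom = y ∧
        ∀ l' : T ⟶ a.left, l' ≫ χ.left = x → l' ≫ a.hom = y → l' = l := by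
    intro T x y e
    obtain ⟨τ, ⟨hτ, eτ⟩, huniq⟩ := @IsStronglyCartesian.universal_property' _ _ _ _ _ _ _ _ _ _ _
      h (Arrow.mk y) (𝟙 _) (Arrow.homMk (g := b) x χ.right e)
      (by
        change (fundamentalFibration B).IsHomLift (𝟙 a.right ≫ χ.right) _
        rw [Category.id_comp]
        exact isHomLift_right (a := Arrow.mk y) (b := b) (Arrow.homMk x χ.right e))
    have hr : τ.right = 𝟙 _ := right_eq_of_isHomLift hτ
    refine ⟨τ.left, congrArg Arrow.Hom.left eτ, ?_, fun l' h₁ h₂ => ?_⟩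
    · have := Arrow.w τ
      rw [hr] at this
      exact this.trans (Category.comp_id _)
    · let τ' : Arrow.mk y ⟶ a := Arrow.homMk l' (𝟙 a.right) (h₂.trans (Category.comp_id _).symm)
      exact congrArg Arrow.Hom.left (huniq τ'
        ⟨isHomLift_right τ', Arrow.hom_ext _ _ h₁ (Category.id_comp _)⟩)
  refine ⟨⟨Arrow.w χ⟩, ⟨PullbackCone.IsLimit.mk _ (fun s => (key s.fst s.snd s.condition).choose)
    (fun s => (key s.fst s.snd s.condition).choose_spec.1)
    (fun s => (key s.fst s.snd s.condition).choose_spec.2.1)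
    (fun s m h₁ h₂ => (key s.fst s.snd s.condition).choose_spec.2.2 m h₁ h₂)⟩⟩

/-- The source and target of a vertical morphism have codomains that are equal only
propositionally; that the codomain component is an isomorphism is all that is needed of it. -/
theorem IsVerticalMono.isIso_right {S Y : Arrow B} {m : S ⟶ Y}
    (hm : IsVerticalMono (fundamentalFibration B) m) : IsIso m.right := by
  obtain ⟨Y₀, J, y, rfl⟩ := Arrow.mk_surjective Y
  obtain ⟨S₀, J', s, rfl⟩ := Arrow.mk_surjective S
  obtain rfl : J' = J :=
    @IsHomLift.domain_eq _ _ _ _ (fundamentalFibration B) _ _ _ _ (𝟙 J) m hm.isHomLift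
  rw [show m.right = 𝟙 J' from right_eq_of_isHomLift hm.isHomLift]
  exact IsIso.id J'

/-- A variant in which the morphism of the base is not written as a codomain component. -/
theorem isPullback_of_isStronglyCartesian_of_fiber {a b : Arrow B} {φ : a ⟶ b}
    {w : a.right ⟶ b.right} (h : (fundamentalFibration B).IsStronglyCartesian w φ) :
    IsPullback φ.left a.hom b.hom φ.right := by
  obtain rfl : φ.right = w := right_eq_of_isHomLift h.toIsHomLift
  exact isPullback_of_isStronglyCartesian φ h

variable {A I : B} {a : A ⟶ I}

/-- An arrow `a : A ⟶ I` as an object of the fibre over `I` of the codomain functor. -/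
abbrev fiberMk (a : A ⟶ I) : Fiber (fundamentalFibration B) I := ⟨Arrow.mk a, rfl⟩

namespace Sub

variable (s : Sub (fundamentalFibration B) (fiberMk a))

/-- The morphism `P(φ)` of an object `(φ, m)` of `Sub_I(a)`. -/
def toBase : s.Y.right ⟶ I := s.base

/-- The domain component of `φ`, for an object `(φ, m)` of `Sub_I(a)`. -/
def proj : s.Y.left ⟶ A := s.φ.left

/-- The first leg of the relation between `P(φ) : J ⟶ I` and `a : A ⟶ I` given by an object of
`Sub_I(a)`, a monomorphism to `J ×_I A`. -/
def fst : s.S.left ⟶ s.Y.right := s.m.left ≫ s.Y.hom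

/-- The second leg of the relation between `P(φ) : J ⟶ I` and `a : A ⟶ I` given by an object of
`Sub_I(a)`, a monomorphism to `J ×_I A`. -/
def snd : s.S.left ⟶ A := s.m.left ≫ s.proj

theorem φ_right : s.φ.right = s.toBase := right_eq_of_isHomLift s.cartesian.toIsHomLift

theorem isPullback_φ : IsPullback s.proj s.Y.hom a s.toBase := by
  rw [← s.φ_right]
  exact isPullback_of_isStronglyCartesian_of_fiber s.cartesian

theorem fst_toBase : s.fst ≫ s.toBase = s.snd ≫ a := by
  rw [fst, snd, Category.assoc, Category.assoc, s.isPullback_φ.w]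

theorem jointlyMonic : JointlyMonic s.fst s.snd := by
  intro T z z' h₁ h₂
  have := s.verticalMono.mono_left
  refine (cancel_mono s.m.left).1 (s.isPullback_φ.hom_ext ?_ ?_)
  · simpa [snd] using h₂
  · simpa [fst] using h₁

theorem S_hom_m_right : s.S.hom ≫ s.m.right = s.fst := (Arrow.w s.m).symm

variable {s} in
theorem hom_ext {t : Sub (fundamentalFibration B) (fiberMk a)} {f g : s ⟶ t}
    (h : f.θ.right = g.θ.right) : f = g := by
  refine Hom.ext (Arrow.hom_ext _ _ (t.isPullback_φ.hom_ext ?_ ?_) h)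
  · exact (congrArg Arrow.Hom.left f.comm).trans (congrArg Arrow.Hom.left g.comm).symm
  · rw [Arrow.w f.θ, h, Arrow.w g.θ]

/-- Morphisms of `Sub_I(a)` are the morphisms `g` over `I` such that the relation of the source is
the inverse image along `g` of the relation of the target: cartesianness of the morphism between
the subobjects says precisely this. -/
theorem exists_hom_iff (t : Sub (fundamentalFibration B) (fiberMk a))
    (g : s.Y.right ⟶ t.Y.right) : (∃ f : s ⟶ t, f.θ.right = g) ↔ g ≫ t.toBase = s.toBase ∧
      ∀ ⦃T : B⦄ (x : T ⟶ s.Y.right) (y : T ⟶ A),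
        Related s.fst s.snd x y ↔ Related t.fst t.snd (x ≫ g) y := by
  have := s.verticalMono.isIso_right
  have := t.verticalMono.isIso_right
  constructor
  · rintro ⟨f, rfl⟩
    obtain ⟨θ', hθ', e⟩ := f.exists_cartesian
    have hp := isPullback_of_isStronglyCartesian θ' hθ'
    have el : s.m.left ≫ f.θ.left = θ'.left ≫ t.m.left := congrArg Arrow.Hom.left e
    have er : s.m.right ≫ f.θ.right = θ'.right ≫ t.m.right := congrArg Arrow.Hom.right e
    have ef : f.θ.left ≫ t.proj = s.proj := congrArg Arrow.Hom.left f.comm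
    have h₁ : θ'.left ≫ t.fst = s.fst ≫ f.θ.right := by
      rw [fst, fst, ← Category.assoc, ← el, Category.assoc, Category.assoc, Arrow.w]
    have h₂ : θ'.left ≫ t.snd = s.snd := by
      rw [snd, snd, ← Category.assoc, ← el, Category.assoc, ef]
    refine ⟨?_, fun T x y => ⟨?_, ?_⟩⟩
    · rw [← t.φ_right, ← s.φ_right]
      exact congrArg Arrow.Hom.right f.comm
    · rintro ⟨z, rfl, rfl⟩
      exact ⟨z ≫ θ'.left, by simp [h₁], by simp [h₂]⟩
    · rintro ⟨z, hz, rfl⟩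
      have hw : z ≫ t.S.hom = (x ≫ inv s.m.right) ≫ θ'.right := by
        rw [← cancel_mono t.m.right, Category.assoc, t.S_hom_m_right, hz, Category.assoc,
          ← er, Category.assoc, IsIso.inv_hom_id_assoc]
      refine ⟨hp.lift _ _ hw, ?_, ?_⟩
      · rw [← s.S_hom_m_right, ← Category.assoc, hp.lift_snd, Category.assoc, IsIso.inv_hom_id,
          Category.comp_id]
      · rw [← h₂, ← Category.assoc, hp.lift_fst]
  · rintro ⟨hg, hr⟩
    have hw : s.proj ≫ a = (s.Y.hom ≫ g) ≫ t.toBase := by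
      rw [Category.assoc, hg, s.isPullback_φ.w]
    let θ : s.Y ⟶ t.Y := Arrow.homMk (t.isPullback_φ.lift _ _ hw) g (t.isPullback_φ.lift_snd _ _ _)
    obtain ⟨l, hl₁, hl₂⟩ := (hr s.fst s.snd).1 ⟨𝟙 _, by simp, by simp⟩
    have hlw : l ≫ t.S.hom = s.S.hom ≫ s.m.right ≫ g ≫ inv t.m.right := by
      rw [← cancel_mono t.m.right, Category.assoc, t.S_hom_m_right, hl₁, ← s.S_hom_m_right]
      simp
    let θ' : s.S ⟶ t.S := Arrow.homMk l (s.m.right ≫ g ≫ inv t.m.right) hlw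
    have hθ' : IsPullback θ'.left s.S.hom t.S.hom θ'.right := by
      have key : ∀ {T : B} (x : T ⟶ t.S.left) (y : T ⟶ s.S.right),
          x ≫ t.S.hom = y ≫ s.m.right ≫ g ≫ inv t.m.right →
          ∃ z : T ⟶ s.S.left, z ≫ l = x ∧ z ≫ s.S.hom = y := by
        intro T x y e
        obtain ⟨z, hz₁, hz₂⟩ := (hr (y ≫ s.m.right) (x ≫ t.snd)).2 ⟨x, by
          rw [← t.S_hom_m_right, ← Category.assoc, e]
          simp, rfl⟩
        refine ⟨z, t.jointlyMonic _ _ ?_ ?_, ?_⟩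
        · rw [Category.assoc, hl₁, ← Category.assoc, hz₁, ← t.S_hom_m_right, ← Category.assoc, e]
          simp
        · rw [Category.assoc, hl₂, hz₂]
        · rw [← cancel_mono s.m.right, Category.assoc, s.S_hom_m_right, hz₁]
      refine ⟨⟨hlw⟩, ⟨PullbackCone.IsLimit.mk _ (fun c => (key c.fst c.snd c.condition).choose)
        (fun c => (key c.fst c.snd c.condition).choose_spec.1)
        (fun c => (key c.fst c.snd c.condition).choose_spec.2)
        (fun c m h₁ h₂ => s.jointlyMonic _ _ ?_ ?_)⟩⟩
      · rw [← s.S_hom_m_right, ← Category.assoc, ← Category.assoc, h₂,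
          (key c.fst c.snd c.condition).choose_spec.2]
      · rw [← hl₂, ← Category.assoc, ← Category.assoc, (key c.fst c.snd c.condition).choose_spec.1]
        exact congrArg (· ≫ t.snd) h₁
    refine ⟨⟨θ, Arrow.hom_ext _ _ (t.isPullback_φ.lift_fst _ _ _) ?_, θ',
      isStronglyCartesian_of_isPullback θ' hθ', Arrow.hom_ext _ _ ?_ ?_⟩, rfl⟩
    · change g ≫ t.φ.right = s.φ.right
      rw [t.φ_right, s.φ_right, hg]
    · change s.m.left ≫ t.isPullback_φ.lift _ _ hw = l ≫ t.m.left
      refine t.isPullback_φ.hom_ext ?_ ?_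
      · rw [Category.assoc, IsPullback.lift_fst, Category.assoc]
        exact hl₂.symm
      · rw [Category.assoc, IsPullback.lift_snd, Category.assoc, ← Category.assoc]
        exact hl₁.symm
    · change s.m.right ≫ g = (s.m.right ≫ g ≫ inv t.m.right) ≫ t.m.right
      simp

/-- The object of `Sub_I(a)` with a given relation over `I`. -/
noncomputable def ofRelation [HasPullbacks B] {J R : B} (w : J ⟶ I) (r₁ : R ⟶ J) (r₂ : R ⟶ A)
    (hw : r₁ ≫ w = r₂ ≫ a) (hr : JointlyMonic r₁ r₂) :
    Sub (fundamentalFibration B) (fiberMk a) where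
  Y := Arrow.mk (pullback.snd a w)
  S := Arrow.mk r₁
  base := w
  φ := Arrow.homMk (g := Arrow.mk a) (pullback.fst a w) w pullback.condition
  cartesian := isStronglyCartesian_of_isPullback (a := Arrow.mk (pullback.snd a w))
    (b := Arrow.mk a) (Arrow.homMk (pullback.fst a w) w pullback.condition)
    (IsPullback.of_hasPullback a w)
  m := Arrow.homMk (pullback.lift r₂ r₁ hw.symm) (𝟙 J)
    ((pullback.lift_snd _ _ _).trans (Category.comp_id _).symm)
  verticalMono := by
    -- both legs of the relation are recovered from the monomorphism to the pullback
    refine ⟨isHomLift_right (a := Arrow.mk r₁) (b := Arrow.mk (pullback.snd a w))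
      (Arrow.homMk (pullback.lift r₂ r₁ hw.symm) (𝟙 J) _), fun {Z} g h _ _ e => ?_⟩
    have el : g.left ≫ pullback.lift r₂ r₁ hw.symm = h.left ≫ pullback.lift r₂ r₁ hw.symm :=
      congrArg Arrow.Hom.left e
    have er : g.right ≫ 𝟙 J = h.right ≫ 𝟙 J := congrArg Arrow.Hom.right e
    have h₁ : g.left ≫ r₁ = h.left ≫ r₁ := by
      simpa only [Category.assoc, pullback.lift_snd] using congrArg (· ≫ pullback.snd a w) el
    have h₂ : g.left ≫ r₂ = h.left ≫ r₂ := by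
      simpa only [Category.assoc, pullback.lift_fst] using congrArg (· ≫ pullback.fst a w) el
    exact Arrow.hom_ext _ _ (hr _ _ h₁ h₂)
      ((Category.comp_id _).symm.trans (er.trans (Category.comp_id _)))

theorem related_ofRelation [HasPullbacks B] {J R T : B} (w : J ⟶ I) (r₁ : R ⟶ J) (r₂ : R ⟶ A)
    (hw : r₁ ≫ w = r₂ ≫ a) (hr : JointlyMonic r₁ r₂) (x : T ⟶ J) (y : T ⟶ A) :
    Related (ofRelation w r₁ r₂ hw hr).fst (ofRelation w r₁ r₂ hw hr).snd x y ↔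
      Related r₁ r₂ x y := by
  have h₁ : (ofRelation w r₁ r₂ hw hr).fst = r₁ := pullback.lift_snd _ _ _
  have h₂ : (ofRelation w r₁ r₂ hw hr).snd = r₂ := pullback.lift_fst _ _ _
  exact iff_of_eq (congrArg₂ (fun q₁ q₂ => Related q₁ q₂ x y) h₁ h₂)

end Sub

/-- Terminal objects of `Sub_I(a)` are power objects of `a`. -/
theorem isWellPowered_iff [HasPullbacks B] :
    IsWellPowered (fundamentalFibration B) ↔ HasRelativePowerObjects B := by
  constructor
  · intro h A I a
    have := h I (fiberMk a)
    let t := ⊤_ (Sub (fundamentalFibration B) (fiberMk a))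
    refine ⟨t.Y.right, t.S.left, t.toBase, t.fst, t.snd, t.fst_toBase, t.jointlyMonic,
      fun {J R} w r₁ r₂ hw hr => ?_⟩
    let s := Sub.ofRelation w r₁ r₂ hw hr
    have hs := fun g : J ⟶ t.Y.right => (s.exists_hom_iff t g).trans (and_congr_right' <|
      forall₃_congr fun T x y => iff_congr (Sub.related_ofRelation w r₁ r₂ hw hr x y) Iff.rfl)
    refine ⟨(terminal.from s).θ.right, (hs _).1 ⟨_, rfl⟩, fun g hg => ?_⟩
    obtain ⟨f, rfl⟩ := (hs g).2 hg
    rw [Subsingleton.elim f (terminal.from s)]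
  · rintro h I ⟨a, rfl⟩
    obtain ⟨A, I, a, rfl⟩ := Arrow.mk_surjective a
    obtain ⟨P, E, p, e₁, e₂, hP⟩ := h a
    let t : Sub (fundamentalFibration B) (fiberMk a) := Sub.ofRelation p e₁ e₂ hP.w hP.jointlyMonic
    have ht : ∀ s : Sub (fundamentalFibration B) (fiberMk a), ∃! g : s.Y.right ⟶ t.Y.right,
        ∃ f : s ⟶ t, f.θ.right = g := fun s => by
      obtain ⟨g, hg, huniq⟩ := hP.existsUnique s.toBase s.fst s.snd s.fst_toBase s.jointlyMonic
      have hs := fun g : s.Y.right ⟶ P => (s.exists_hom_iff t g).trans (and_congr_right' <|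
        forall₃_congr fun T x y => iff_congr Iff.rfl
          (Sub.related_ofRelation p e₁ e₂ hP.w hP.jointlyMonic (x ≫ g) y))
      exact ⟨g, (hs g).2 hg, fun g' hg' => huniq g' ((hs g').1 hg')⟩
    change HasTerminal (Sub (fundamentalFibration B) (fiberMk a))
    exact IsTerminal.hasTerminal (X := t) (IsTerminal.ofUniqueHom
      (fun s => (ht s).choose_spec.1.choose) fun s f => Sub.hom_ext
        (((ht s).choose_spec.2 _ ⟨f, rfl⟩).trans (ht s).choose_spec.1.choose_spec.symm))

end WellPowered

/-! ### Local smallness of the codomain functor -/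

section LocallySmall

variable {B : Type u} [Category.{v} B]

namespace SpanHom

variable {A C I : B} {a : A ⟶ I} {c : C ⟶ I}
  (s : SpanHom (fundamentalFibration B) (fiberMk a) (fiberMk c))

/-- The common image in the base of the two legs of a span. -/
def toBase : s.U.right ⟶ I := s.base

/-- The domain component of the cartesian leg of a span. -/
def fst : s.U.left ⟶ A := s.φ.left

/-- The domain component of the second leg of a span. -/
def snd : s.U.left ⟶ C := s.f.left

theorem φ_right : s.φ.right = s.toBase := right_eq_of_isHomLift s.cartesian.toIsHomLift

theorem f_right : s.f.right = s.toBase := right_eq_of_isHomLift s.isHomLift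

theorem isPullback : IsPullback s.fst s.U.hom a s.toBase := by
  rw [← s.φ_right]
  exact isPullback_of_isStronglyCartesian_of_fiber s.cartesian

theorem snd_comp : s.snd ≫ c = s.U.hom ≫ s.toBase := by
  rw [← s.f_right]
  exact Arrow.w s.f

end SpanHom

attribute [local simp] pullback.lift_fst pullback.lift_snd pullback.lift_fst_assoc

variable [HasFiniteLimits B]

/-- Spans over `w : J ⟶ I` are sections over `J ×_I A` of the projection `A ×_I C ⟶ A`, so they are
represented by a dependent product along `a : A ⟶ I`. -/
theorem isLocallySmall_of_hasRelativePowerObjects (hB : HasRelativePowerObjects B) :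
    IsLocallySmall (fundamentalFibration B) := by
  rintro I ⟨a, rfl⟩ ⟨c, hc⟩
  obtain ⟨A, I, a, rfl⟩ := Arrow.mk_surjective a
  obtain ⟨C, I', c, rfl⟩ := Arrow.mk_surjective c
  obtain rfl : I' = I := hc
  obtain ⟨Q, π, ε, hε⟩ := exists_isDependentProduct hB a (pullback.fst a c)
  have hw : (ε ≫ pullback.snd a c) ≫ c = pullback.fst π a ≫ π := by
    rw [Category.assoc, ← pullback.condition, ← Category.assoc, hε.w, pullback.condition]
  let φ : Arrow.mk (pullback.fst π a) ⟶ Arrow.mk a :=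
    Arrow.homMk (pullback.snd π a) π pullback.condition.symm
  let f : Arrow.mk (pullback.fst π a) ⟶ Arrow.mk c := Arrow.homMk (ε ≫ pullback.snd a c) π hw
  let t : SpanHom (fundamentalFibration B) (fiberMk a) (fiberMk c) :=
    ⟨Arrow.mk (pullback.fst π a), π, φ,
      isStronglyCartesian_of_isPullback φ (IsPullback.of_hasPullback π a).flip, f,
      isHomLift_right f⟩
  have key : ∀ s : SpanHom (fundamentalFibration B) (fiberMk a) (fiberMk c),
      ∃ f : s ⟶ t, ∀ f' : s ⟶ t, f' = f := by
    intro s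
    -- the comparison between the domain of the span and the chosen pullback
    let l : pullback s.toBase a ⟶ s.U.left :=
      s.isPullback.lift (pullback.snd _ _) (pullback.fst _ _) pullback.condition.symm
    let l' : s.U.left ⟶ pullback s.toBase a := pullback.lift s.U.hom s.fst s.isPullback.w.symm
    have hl₁ : l ≫ s.fst = pullback.snd _ _ := s.isPullback.lift_fst _ _ _
    have hl₂ : l ≫ s.U.hom = pullback.fst _ _ := s.isPullback.lift_snd _ _ _
    have hl : l ≫ l' = 𝟙 _ := pullback.hom_ext (by simp [l', hl₂]) (by simp [l', hl₁])
    have hl' : l' ≫ l = 𝟙 _ := s.isPullback.hom_ext (by simp [l', hl₁]) (by simp [l', hl₂])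
    obtain ⟨j, ⟨ej, hj⟩, huniq⟩ := hε.existsUnique s.toBase
      (pullback.lift (pullback.snd _ _) (l ≫ s.snd)
        (by rw [Category.assoc, s.snd_comp, ← Category.assoc, hl₂, pullback.condition])) (by simp)
    let θ : s.U ⟶ t.U := Arrow.homMk (g := Arrow.mk (pullback.fst π a))
      (l' ≫ baseChange a j ej) j (by simp [l'])
    refine ⟨⟨θ, Arrow.hom_ext _ _ ?_ ?_, Arrow.hom_ext _ _ ?_ ?_⟩, fun g => ?_⟩
    · change (l' ≫ baseChange a j ej) ≫ pullback.snd π a = s.fst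
      simp [l']
    · exact ej.trans s.φ_right.symm
    · change (l' ≫ baseChange a j ej) ≫ ε ≫ pullback.snd a c = s.snd
      rw [Category.assoc, ← Category.assoc _ ε, hj, pullback.lift_snd, ← Category.assoc, hl',
        Category.id_comp]
    · exact ej.trans s.f_right.symm
    · let g₁ : s.U.left ⟶ pullback π a := g.θ.left
      let g₂ : s.U.right ⟶ Q := g.θ.right
      have eg : g₁ ≫ pullback.fst π a = s.U.hom ≫ g₂ := Arrow.w g.θ
      have eg₁ : g₁ ≫ pullback.snd π a = s.fst := congrArg Arrow.Hom.left g.comm_φ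
      have eg₂ : g₂ ≫ π = s.toBase := (congrArg Arrow.Hom.right g.comm_φ).trans s.φ_right
      have eg₃ : g₁ ≫ ε ≫ pullback.snd a c = s.snd := congrArg Arrow.Hom.left g.comm_f
      have hg : g₁ = l' ≫ baseChange a g₂ eg₂ :=
        pullback.hom_ext (by simp [l', eg]) (by simp [l', eg₁])
      have hg' : l ≫ g₁ = baseChange a g₂ eg₂ := by
        rw [hg, ← Category.assoc, hl, Category.id_comp]
      obtain rfl : g₂ = j := huniq g₂ ⟨eg₂, by
        refine pullback.hom_ext (by simp [hε.w]) ?_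
        rw [← hg', Category.assoc, Category.assoc, eg₃, pullback.lift_snd]⟩
      exact SpanHom.Hom.ext (Arrow.hom_ext _ _ hg rfl)
  change HasTerminal (SpanHom (fundamentalFibration B) (fiberMk a) (fiberMk c))
  exact IsTerminal.hasTerminal (X := t) (IsTerminal.ofUniqueHom (fun s => (key s).choose)
    fun s => (key s).choose_spec)

end LocallySmall

end FibredCat

theorem mainTheorem9 (B : Type u) [Category.{v} B] [HasFiniteLimits B] :
    (FibredCat.IsElementaryTopos B ↔
      FibredCat.IsWellPowered (FibredCat.fundamentalFibration B)) ∧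
    (FibredCat.IsWellPowered (FibredCat.fundamentalFibration B) →
      FibredCat.IsLocallySmall (FibredCat.fundamentalFibration B)) ∧
    (FibredCat.IsElementaryTopos B → FibredCat.IsLocallyCartesianClosed B) := by
  rw [FibredCat.isWellPowered_iff]
  exact ⟨⟨fun h => h.hasRelativePowerObjects,
      FibredCat.isElementaryTopos_of_hasRelativePowerObjects⟩,
    FibredCat.isLocallySmall_of_hasRelativePowerObjects,
    fun h => FibredCat.isLocallyCartesianClosed_of_hasRelativePowerObjects
      h.hasRelativePowerObjects⟩
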